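/- Let $k$ be a (left) Noetherian ring. An FI-module over $k$ is a functor $V$ from the category FI of finite sets and injections to the category of (left) $k$-modules, and a sub-FI-module of $V$ is a family of submodules $W(S)\subseteq V(S)$, one for each finite set $S$, preserved by all maps induced by injections. Write $V_n := V(\{1,\dots,n\})$; $V$ is finitely generated if there is a finite set of elements of $\coprod_{n\ge 0} V_n$ that is contained in no proper sub-FI-module of $V$. Let $E_r^{p,q}$ ($r\ge 2$, $p,q\ge 0$) be a first-quadrant cohomological spectral sequence of FI-modules over $k$, with differentials $d_r\colon E_r^{p,q}\to E_r^{p+r,\,q-r+1}$, and suppose that it converges to a sequence of FI-modules $H^n=H^n(X;k)$, $n\ge 0$: each $H^n$ has a filtration by sub-FI-modules $H^n=F^0H^n\supseteq F^1H^n\supseteq\cdots\supseteq F^{n+1}H^n=0$ with isomorphisms of FI-modules $F^pH^n/F^{p+1}H^n\cong E_\infty^{p,n-p}$ for $0\le p\le n$, where $E_\infty^{p,q}$ is the common value of $E_r^{p,q}$ for $r\ge\max(p+1,q+2)$. If the FI-module $E_2^{p,q}$ is finitely generated for all $p,q\ge 0$, then the FI-module $H^i(X;k)$ is finitely generated for every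 $i\ge 0$. -/

import Mathlib

/-! Over a left Noetherian ring, a finitely generated `FI`-module satisfies the ascending chain
condition on sub-`FI`-modules. Indeed, order the monomials of the covering free module by generator
and then lexicographically. A sub-`FI`-module is determined, within a chain, by its left ideals of
leading coefficients; these form a monotone function from the monomials, preordered by divisibility,
to the left ideals of `k`. Divisibility is a well-quasi-order by Higman's lemma, so such functions
satisfy the ascending chain condition.

The `FI`-modules with this chain condition form a Serre class, and each of them is finitely
generated. Every Serre class passes from `E₂` to the abutment: `E_∞^{p,q}` is a subquotient of
`E₂^{p,q}`, and `Hⁿ` is an iterated extension of the `E_∞^{p,q}` with `p + q = n`. -/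

open CategoryTheory CategoryTheory.Limits

universe v u

/-- An object of the category `FI`: a finite set (the empty set is allowed). -/
structure FI : Type 1 where
  of ::
  carrier : Type
  [finite : Finite carrier]

namespace FI

/-- Morphisms of `FI` are the injections. -/
instance : Category FI where
  Hom S T := S.carrier ↪ T.carrier
  id S := Function.Embedding.refl S.carrier
  comp f g := Function.Embedding.trans f g

/-- The standard set with `n` elements, as an object of `FI`. -/
def std (n : ℕ) : FI := FI.of (Fin n)

end FI

/-- An `FI`-module over `k`: a functor from finite sets and injections to (left) `k`-modules.
Morphisms of `FI`-modules are the natural transformations. -/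
abbrev FIModule (k : Type u) [Ring k] := FI ⥤ ModuleCat.{v} k

namespace FIModule

variable {k : Type u} [Ring k]

/-- A sub-`FI`-module of `V`: a submodule of `V(S)` for every finite set `S`, such that these are
preserved by the maps induced by injections. -/
structure Sub (V : FIModule.{v} k) where
  obj (S : FI) : Submodule k (V.obj S)
  map_mem {S T : FI} (f : S ⟶ T) (x : V.obj S) : x ∈ obj S → (V.map f).hom x ∈ obj T

/-- `V` is finitely generated if there is a finite set `s` of elements of `∐ₙ Vₙ`
(where `Vₙ` is the value of `V` on the standard set with `n` elements) such that the only
sub-`FI`-module of `V` containing `s` is `V` itself. -/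
def IsFinitelyGenerated (V : FIModule.{v} k) : Prop :=
  ∃ s : Set (Σ n : ℕ, V.obj (FI.std n)), s.Finite ∧
    ∀ W : Sub V, (∀ x ∈ s, x.2 ∈ W.obj (FI.std x.1)) → ∀ S : FI, W.obj S = ⊤

end FIModule

namespace FirstQuadrant

variable {C : Type*} [Category C] [Abelian C]

/-- The `r`-th page (`2 ≤ r`) at position `(p, q)`. -/
noncomputable abbrev term (E : E₂CohomologicalSpectralSequenceNat C) (r : ℤ) (p q : ℕ)
    (hr : 2 ≤ r := by lia) : C :=
  (E.page r hr).X (p, q)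

/-- In a first quadrant spectral sequence no nonzero differential enters or leaves position
`(p, q)` on the pages `r ≥ max (p + 1) (q + 2)`, so the terms there are all the same. -/
theorem term_succ_iso (E : E₂CohomologicalSpectralSequenceNat C) (p q : ℕ) (r : ℤ)
    (hr : max ((p : ℤ) + 1) (q + 2) ≤ r) :
    Nonempty (term E r p q ≅ term E (r + 1) p q) := by
  have h2 : 2 ≤ r := by lia
  have hf : ∀ pq, (E.page r h2).d (p, q) pq = 0 := fun pq =>
    (E.page r h2).shape _ _ (by
      rw [ComplexShape.spectralSequenceNat_rel_iff]; dsimp only; lia)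
  have ht : ∀ pq, (E.page r h2).d pq (p, q) = 0 := fun pq =>
    (E.page r h2).shape _ _ (by
      rw [ComplexShape.spectralSequenceNat_rel_iff]; dsimp only; lia)
  have := ((E.page r h2).sc (p, q)).isIso_iCycles (hf _)
  have := ((E.page r h2).sc (p, q)).isIso_homologyπ (ht _)
  exact ⟨(asIso ((E.page r h2).sc (p, q)).iCycles).symm ≪≫
    asIso ((E.page r h2).sc (p, q)).homologyπ ≪≫ E.iso r (r + 1) (p, q)⟩

/-- The term `E_∞^{p,q}` of a first quadrant spectral sequence: the common value (up to
isomorphism) of `E_r^{p,q}` for `r ≥ max (p + 1) (q + 2)`. -/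
noncomputable def infTerm (E : E₂CohomologicalSpectralSequenceNat C) (p q : ℕ) : C :=
  term E (max ((p : ℤ) + 1) (q + 2)) p q

/-- Convergence `E_r^{p,q} ⇒ H^{p+q}` of a first quadrant spectral sequence: every `Hⁿ` has a
decreasing filtration `Hⁿ = F⁰Hⁿ ⊇ F¹Hⁿ ⊇ ⋯ ⊇ Fⁿ⁺¹Hⁿ = 0` by subobjects together with
isomorphisms `FᵖHⁿ / Fᵖ⁺¹Hⁿ ≅ E_∞^{p,q}` for all `p + q = n`. -/
structure ConvergesTo (E : E₂CohomologicalSpectralSequenceNat C) (H : ℕ → C) where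
  F (n p : ℕ) : Subobject (H n)
  antitone (n : ℕ) : Antitone (F n)
  F_zero (n : ℕ) : F n 0 = ⊤
  F_last (n : ℕ) : F n (n + 1) = ⊥
  gradedIso (n p q : ℕ) (hpq : p + q = n) :
    cokernel (Subobject.ofLE (F n (p + 1)) (F n p) (antitone n p.le_succ)) ≅ infTerm E p q

end FirstQuadrant

/-- If `F 0 < F 1 < ⋯` is strict at the arguments `a 0, a 1, …`, then along a monotone subsequence
of `a` the values `F (i + 1) (a i)` form a strictly increasing sequence in `β`. -/
theorem wellFoundedGT_orderHom {α β : Type*} [Preorder α] [WellQuasiOrderedLE α] [PartialOrder β]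
    [WellFoundedGT β] : WellFoundedGT (α →o β) := by
  refine ⟨RelEmbedding.wellFounded_iff_isEmpty.2 ⟨fun F => ?_⟩⟩
  have hF {i j : ℕ} (h : i < j) : F i < F j := F.map_rel_iff.2 h
  choose a ha using fun i : ℕ => (Pi.lt_def.1 (hF i.lt_succ_self)).2
  obtain ⟨g, hg⟩ := wellQuasiOrdered_le.exists_monotone_subseq a
  refine not_strictMono_of_wellFoundedGT (fun i => F (g i + 1) (a (g i)))
    (strictMono_nat_of_lt_succ fun i => ?_)
  calc
    F (g i + 1) (a (g i)) ≤ F (g i + 1) (a (g (i + 1))) := (F _).monotone (hg _ _ i.le_succ)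
    _ ≤ F (g (i + 1)) (a (g (i + 1))) := by
      have : g i + 1 ≤ g (i + 1) := g.strictMono i.lt_succ_self
      obtain h | h := this.eq_or_lt
      · rw [h]
      · exact (hF h).le _
    _ < F (g (i + 1) + 1) (a (g (i + 1))) := ha _

section LeadingCoeffs

variable {R M M' ι ι' : Type*} [Ring R] [AddCommGroup M] [Module R M] [AddCommGroup M']
  [Module R M']

/-- The left ideal of leading coefficients at `e` of the submodule `W`: those `c` such that `W`
contains an element of the form `c • b e` plus a combination of the `b e'` with `e' < e`. -/
def leadingCoeffs [Preorder ι] (b : ι → M) (e : ι) (W : Submodule R M) : Ideal R :=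
  (W ⊔ Submodule.span R (b '' Set.Iio e)).comap (LinearMap.toSpanSingleton R M (b e))

theorem leadingCoeffs_mono [Preorder ι] (b : ι → M) (e : ι) :
    Monotone (leadingCoeffs (R := R) b e) :=
  fun _ _ h => Submodule.comap_mono (sup_le_sup_right h _)

theorem leadingCoeffs_le_of_map_le [Preorder ι] [Preorder ι'] {b : ι → M} {b' : ι' → M'}
    {φ : M →ₗ[R] M'} {ψ : ι → ι'} (hψ : StrictMono ψ) (hb : ∀ e, φ (b e) = b' (ψ e))
    {W : Submodule R M} {W' : Submodule R M'} (hW : W.map φ ≤ W') (e : ι) :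
    leadingCoeffs b e W ≤ leadingCoeffs b' (ψ e) W' := by
  intro c (hc : c • b e ∈ W ⊔ Submodule.span R (b '' Set.Iio e))
  have hlower : (Submodule.span R (b '' Set.Iio e)).map φ ≤
      Submodule.span R (b' '' Set.Iio (ψ e)) := by
    rw [Submodule.map_span, ← Set.image_comp]
    refine Submodule.span_mono ?_
    rintro _ ⟨e', he', rfl⟩
    exact ⟨ψ e', hψ he', (hb e').symm⟩
  have hφ := Submodule.mem_map_of_mem (f := φ) hc
  rw [Submodule.map_sup, map_smul, hb] at hφ
  exact sup_le_sup hW hlower hφ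

theorem inf_span_image_le_of_isLowerSet [LinearOrder ι] (b : ι → M) {T : Set ι} (hT : IsLowerSet T)
    {W W' : Submodule R M}
    (h : ∀ e ∈ T, W' ⊓ Submodule.span R (b '' Set.Iic e) ≤ W) :
    W' ⊓ Submodule.span R (b '' T) ≤ W := by
  have hspan : Submodule.span R (b '' T) = ⨆ e : T, Submodule.span R (b '' Set.Iic (e : ι)) := by
    refine le_antisymm (Submodule.span_le.2 ?_) (iSup_le fun e => ?_)
    · rintro _ ⟨e, he, rfl⟩
      exact Submodule.mem_iSup_of_mem ⟨e, he⟩ (Submodule.subset_span ⟨e, le_rfl, rfl⟩)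
    · exact Submodule.span_mono (Set.image_mono (hT.Iic_subset e.2))
  have hmono : Monotone fun e : T => Submodule.span R (b '' Set.Iic (e : ι)) := fun _ _ h =>
    Submodule.span_mono (Set.image_mono (Set.Iic_subset_Iic.2 h))
  rw [hspan, hmono.directed_le.inf_iSup_eq]
  exact iSup_le fun e => h e e.2

theorem le_of_leadingCoeffs_le [LinearOrder ι] [WellFoundedLT ι] {b : ι → M}
    (hb : Submodule.span R (Set.range b) = ⊤) {W W' : Submodule R M} (hle : W ≤ W')
    (h : ∀ e, leadingCoeffs b e W' ≤ leadingCoeffs b e W) : W' ≤ W := by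
  suffices hIic : ∀ e, W' ⊓ Submodule.span R (b '' Set.Iic e) ≤ W by
    simpa [hb] using inf_span_image_le_of_isLowerSet b isLowerSet_univ fun e _ => hIic e
  intro e
  induction e using WellFoundedLT.induction with | ind e ih
  have hIio : W' ⊓ Submodule.span R (b '' Set.Iio e) ≤ W :=
    inf_span_image_le_of_isLowerSet b (isLowerSet_Iio e) ih
  rintro x ⟨hxW', hx⟩
  rw [← Set.Iio_insert, Set.image_insert_eq, SetLike.mem_coe, Submodule.mem_span_insert] at hx
  obtain ⟨c, l, hl, rfl⟩ := hx
  have hc : c ∈ leadingCoeffs b e W' := by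
    refine Submodule.mem_sup.2 ⟨_, hxW', -l, neg_mem hl, ?_⟩
    simp
  obtain ⟨w, hw, l', hl', hwl⟩ := Submodule.mem_sup.1 (h e hc)
  rw [LinearMap.toSpanSingleton_apply] at hwl
  have hlow : l' + l ∈ W := hIio ⟨by
    simpa [← hwl, add_assoc] using sub_mem hxW' (hle hw), add_mem hl' hl⟩
  rw [← hwl, add_assoc]
  exact add_mem hw hlow

end LeadingCoeffs

namespace FI

/-- An increasing map as a morphism between standard sets. -/
def orderHom {N N' : ℕ} (g : Fin N ↪o Fin N') : std N ⟶ std N' := g.toEmbedding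

/-- A basis element of the free `FI`-module on generators indexed by `ι`, the `i`-th one in degree
`d i`, evaluated at `N`: a generator together with an injection out of its degree. -/
structure Monomial {ι : Type*} (d : ι → ℕ) (N : ℕ) where
  gen : ι
  inj : Fin (d gen) ↪ Fin N

namespace Monomial

variable {ι : Type*} {d : ι → ℕ} {N N' : ℕ}

/-- The generator, and then the values of the injection: comparing these lexicographically gives
the term order on monomials. -/
def lexKey (m : Monomial d N) : Σₗ i, Lex (Fin (d i) → Fin N) :=
  toLex ⟨m.gen, toLex m.inj⟩

theorem lexKey_injective : Function.Injective (lexKey (d := d) (N := N)) := by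
  rintro ⟨i, f⟩ ⟨j, g⟩ h
  obtain ⟨rfl, h⟩ := Sigma.mk.inj_iff.1 (toLex.injective h)
  exact congrArg (mk i) (DFunLike.coe_injective (toLex.injective (eq_of_heq h)))

noncomputable instance [LinearOrder ι] : LinearOrder (Monomial d N) :=
  LinearOrder.lift' lexKey lexKey_injective

instance [Finite ι] : Finite (Monomial d N) :=
  .of_injective (β := Σ i, Fin (d i) → Fin N) lexKey lexKey_injective

/-- The injection of a monomial as a morphism of `FI`. -/
def hom (m : Monomial d N) : std (d m.gen) ⟶ std N := m.inj

/-- Postcomposition with an increasing map. -/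
def map (g : Fin N ↪o Fin N') (m : Monomial d N) : Monomial d N' :=
  ⟨m.gen, m.inj.trans g.toEmbedding⟩

theorem map_strictMono [LinearOrder ι] (g : Fin N ↪o Fin N') :
    StrictMono (map (d := d) g) := by
  rintro ⟨i, f⟩ ⟨j, f'⟩ h
  obtain hij | ⟨hij, hlex⟩ := Sigma.lex_iff.1 h
  · exact Sigma.lex_iff.2 (.inl hij)
  · obtain rfl : i = j := hij
    obtain ⟨a, heq, hlt⟩ := hlex
    exact Sigma.lex_iff.2 <| .inr
      ⟨rfl, a, fun b hb => congrArg g (heq b hb), g.strictMono hlt⟩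

/-- The monomials of all degrees, preordered by divisibility: `m` divides its images under
increasing maps. -/
structure Total (d : ι → ℕ) where
  degree : ℕ
  monomial : Monomial d degree

namespace Total

instance : Preorder (Total d) where
  le m m' := ∃ g : Fin m.degree ↪o Fin m'.degree, m.monomial.map g = m'.monomial
  le_refl _ := ⟨RelEmbedding.refl _, rfl⟩
  le_trans _ _ _ := by
    rintro ⟨g, hg⟩ ⟨g', hg'⟩
    exact ⟨g.trans g', by rw [← hg', ← hg]; rfl⟩

/-- The fibres of the injection, as a word over a finite alphabet not depending on the generator. -/
def word (m : Total d) : List (Set (Σ i, Fin (d i))) :=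
  List.ofFn fun x => Sigma.mk m.monomial.gen '' (m.monomial.inj ⁻¹' {x})

theorem le_of_word_sublist {m m' : Total d} (hgen : m.monomial.gen = m'.monomial.gen)
    (hword : m.word.Sublist m'.word) : m ≤ m' := by
  obtain ⟨N, i, f⟩ := m
  obtain ⟨N', j, f'⟩ := m'
  obtain rfl : i = j := hgen
  obtain ⟨g, hg⟩ := List.sublist_iff_exists_fin_orderEmbedding_get_eq.1 hword
  let g' : Fin N ↪o Fin N' := ((Fin.castOrderIso List.length_ofFn.symm).toOrderEmbedding.trans
    g).trans (Fin.castOrderIso List.length_ofFn).toOrderEmbedding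
  have hfibre (x : Fin N) : (Sigma.mk i '' (f ⁻¹' {x}) : Set (Σ i, Fin (d i))) =
      Sigma.mk i '' (f' ⁻¹' {g' x}) := by
    have := hg (Fin.cast List.length_ofFn.symm x)
    simp only [word, List.get_ofFn] at this
    exact this
  refine ⟨g', congrArg (Monomial.mk i) (DFunLike.ext _ _ fun a => ?_)⟩
  have ha := Set.image_injective.2 sigma_mk_injective (hfibre (f a))
  exact (ha.le rfl : f' a = g' (f a)).symm

instance [Finite ι] : WellQuasiOrderedLE (Total d) where
  wqo f := by
    have hword : WellQuasiOrdered (List.SublistForall₂ (Eq : Set (Σ i, Fin (d i)) → _ → Prop)) := by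
      have := Set.PartiallyWellOrderedOn.partiallyWellOrderedOn_sublistForall₂
        (Eq : Set (Σ i, Fin (d i)) → _ → Prop) (Set.toFinite Set.univ).partiallyWellOrderedOn
      simpa [Set.partiallyWellOrderedOn_univ_iff] using this
    obtain ⟨a, b, hab, hgen, h⟩ := (Finite.wellQuasiOrdered (Eq : ι → ι → Prop)).prod hword
      fun n => ((f n).monomial.gen, (f n).word)
    obtain ⟨l, hl, hsub⟩ := List.sublistForall₂_iff.1 h
    rw [List.forall₂_eq_eq_eq] at hl
    subst hl
    exact ⟨a, b, hab, le_of_word_sublist hgen hsub⟩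

end Total

end Monomial

theorem exists_iso_std (S : FI) : ∃ n, Nonempty (std n ≅ S) := by
  have := S.finite
  obtain ⟨n, ⟨e⟩⟩ := Finite.exists_equiv_fin S.carrier
  exact ⟨n, ⟨{
    hom := (e.symm.toEmbedding : Fin n ↪ S.carrier)
    inv := (e.toEmbedding : S.carrier ↪ Fin n)
    hom_inv_id := DFunLike.ext (F := Fin n ↪ Fin n) _ _ e.apply_symm_apply
    inv_hom_id := DFunLike.ext (F := S.carrier ↪ S.carrier) _ _ e.symm_apply_apply }⟩⟩

end FI

namespace FIModule

variable {k : Type u} [Ring k] {V V' : FIModule.{v} k}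

theorem naturality_apply (f : V ⟶ V') {S T : FI} (g : S ⟶ T) (x : V.obj S) :
    (f.app T).hom ((V.map g).hom x) = (V'.map g).hom ((f.app S).hom x) :=
  congrArg (fun h => h.hom x) (f.naturality g)

theorem app_surjective (f : V ⟶ V') [Epi f] (S : FI) : Function.Surjective (f.app S).hom :=
  (ModuleCat.epi_iff_surjective _).1 inferInstance

theorem app_injective (f : V ⟶ V') [Mono f] (S : FI) : Function.Injective (f.app S).hom :=
  (ModuleCat.mono_iff_injective _).1 inferInstance

theorem exists_app_eq_of_exact {X : ShortComplex (FIModule.{v} k)} (hX : X.Exact) {S : FI}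
    {x : X.X₂.obj S} (hx : (X.g.app S).hom x = 0) : ∃ y, (X.f.app S).hom y = x :=
  (ShortComplex.moduleCat_exact_iff _).1 (hX.map ((evaluation FI (ModuleCat.{v} k)).obj S)) x hx

namespace Sub

instance : PartialOrder (Sub V) :=
  PartialOrder.lift obj fun ⟨_, _⟩ ⟨_, _⟩ h => by cases h; rfl

instance : OrderTop (Sub V) where
  top := ⟨fun _ => ⊤, fun _ _ _ => trivial⟩
  le_top _ _ := le_top

theorem le_of_obj_std_le {W W' : Sub V} (h : ∀ n, W.obj (FI.std n) ≤ W'.obj (FI.std n)) :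
    W ≤ W' := by
  intro S x hx
  obtain ⟨n, ⟨e⟩⟩ := FI.exists_iso_std S
  simpa [← LinearMap.comp_apply, ← ModuleCat.hom_comp, ← V.map_comp] using
    W'.map_mem e.hom _ (h n (W.map_mem e.inv x hx))

/-- The image of a sub-`FI`-module. -/
def map (f : V ⟶ V') (W : Sub V) : Sub V' where
  obj S := (W.obj S).map (f.app S).hom
  map_mem g x := by
    rintro ⟨y, hy, rfl⟩
    exact ⟨_, W.map_mem g y hy, naturality_apply f g y⟩

/-- The preimage of a sub-`FI`-module. -/
def comap (f : V ⟶ V') (W : Sub V') : Sub V where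
  obj S := (W.obj S).comap (f.app S).hom
  map_mem g x hx := by
    rw [Submodule.mem_comap, naturality_apply]
    exact W.map_mem g _ hx

theorem map_mono (f : V ⟶ V') : Monotone (map f) :=
  fun _ _ h S => Submodule.map_mono (h S)

theorem comap_mono (f : V ⟶ V') : Monotone (comap f) :=
  fun _ _ h S => Submodule.comap_mono (h S)

theorem map_strictMono (f : V ⟶ V') [Mono f] : StrictMono (map f) := fun _ _ h =>
  (map_mono f h.le).lt_of_not_ge fun h' => h.not_ge fun S =>
    (Submodule.map_le_map_iff_of_injective (app_injective f S) _ _).1 (h' S)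

theorem comap_strictMono (f : V ⟶ V') [Epi f] : StrictMono (comap f) := fun _ _ h =>
  (comap_mono f h.le).lt_of_not_ge fun h' => h.not_ge fun S =>
    (Submodule.comap_le_comap_iff_of_surjective (app_surjective f S)).1 (h' S)

theorem comap_map_strictMono {X : ShortComplex (FIModule.{v} k)} (hX : X.Exact) :
    StrictMono fun W : Sub X.X₂ => (W.comap X.f, W.map X.g) := by
  intro W W' h
  refine lt_of_le_not_ge ⟨comap_mono _ h.le, map_mono _ h.le⟩ fun h' => h.not_ge fun S x hx => ?_
  obtain ⟨y, hy, hyx⟩ := h'.2 S ⟨x, hx, rfl⟩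
  obtain ⟨z, hz⟩ := exists_app_eq_of_exact hX (x := x - y) (by rw [map_sub, hyx, sub_self])
  have hzW : z ∈ (W.comap X.f).obj S := h'.1 S (by
    simpa [comap, hz] using sub_mem hx (h.le S hy))
  simpa [hz] using add_mem (show (X.f.app S).hom z ∈ W.obj S from hzW) hy

/-- The sub-`FI`-module generated by a set of elements of `∐ₙ Vₙ`. -/
def span (s : Set (Σ n, V.obj (FI.std n))) : Sub V where
  obj S := Submodule.span k {y | ∃ x ∈ s, ∃ f : FI.std x.1 ⟶ S, (V.map f).hom x.2 = y}
  map_mem {S T} g y hy := by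
    refine Submodule.span_mono ?_ (Submodule.mem_map_of_mem (f := (V.map g).hom) hy |>
      (Submodule.map_span _ _).le)
    rintro _ ⟨_, ⟨x, hx, f, rfl⟩, rfl⟩
    exact ⟨x, hx, f ≫ g, by simp⟩

variable {s t : Set (Σ n, V.obj (FI.std n))}

theorem span_le {W : Sub V} : span s ≤ W ↔ ∀ x ∈ s, x.2 ∈ W.obj (FI.std x.1) := by
  refine ⟨fun h x hx => h _ (Submodule.subset_span ⟨x, hx, 𝟙 _, by simp⟩), fun h S => ?_⟩
  refine Submodule.span_le.2 ?_
  rintro _ ⟨x, hx, f, rfl⟩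
  exact W.map_mem f _ (h x hx)

theorem mem_span {x : Σ n, V.obj (FI.std n)} (hx : x ∈ s) : x.2 ∈ (span s).obj (FI.std x.1) :=
  span_le.1 le_rfl x hx

theorem span_mono (h : s ⊆ t) : span s ≤ span t :=
  span_le.2 fun _ hx => mem_span (h hx)

end Sub

theorem isFinitelyGenerated_iff_span :
    V.IsFinitelyGenerated ↔ ∃ s, s.Finite ∧ Sub.span (V := V) s = ⊤ := by
  refine exists_congr fun s => and_congr_right fun _ => ⟨fun h => ?_, fun h W hW S => ?_⟩
  · exact top_unique fun S => (h _ (fun _ => Sub.mem_span) S).ge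
  · exact top_unique ((h.ge.trans (Sub.span_le.2 hW)) S)

/-- The `FI`-modules whose sub-`FI`-modules satisfy the ascending chain condition. -/
def isNoetherian (k : Type u) [Ring k] : ObjectProperty (FIModule.{v} k) :=
  fun V => WellFoundedGT (Sub V)

theorem isNoetherian_of_isZero (hV : IsZero V) : isNoetherian k V := by
  have (S : FI) : Subsingleton (V.obj S) :=
    ModuleCat.subsingleton_of_isZero (((evaluation FI (ModuleCat.{v} k)).obj S).map_isZero hV)
  have : Subsingleton (Sub V) := ⟨fun W W' => le_antisymm
    (fun S x _ => Subsingleton.elim 0 x ▸ zero_mem _)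
    fun S x _ => Subsingleton.elim 0 x ▸ zero_mem _⟩
  exact inferInstanceAs (WellFoundedGT (Sub V))

open ZeroObject in
instance : (isNoetherian.{v} k).IsSerreClass where
  exists_zero := ⟨0, isZero_zero _, isNoetherian_of_isZero (isZero_zero _)⟩
  prop_of_mono f _ (_ : WellFoundedGT _) := (Sub.map_strictMono f).wellFoundedGT
  prop_of_epi f _ (_ : WellFoundedGT _) := (Sub.comap_strictMono f).wellFoundedGT
  prop_X₂_of_shortExact hX (_ : WellFoundedGT _) (_ : WellFoundedGT _) :=
    (Sub.comap_map_strictMono hX.exact).wellFoundedGT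

theorem isNoetherian.isFinitelyGenerated (hV : isNoetherian k V) : V.IsFinitelyGenerated := by
  have : WellFoundedGT (Sub V) := hV
  obtain ⟨_, ⟨s, hs, rfl⟩, hmax⟩ := exists_maximal_of_wellFoundedGT
    (fun W : Sub V => ∃ s, s.Finite ∧ Sub.span s = W) ⟨_, ∅, Set.finite_empty, rfl⟩
  refine isFinitelyGenerated_iff_span.2 ⟨s, hs, top_unique (Sub.le_of_obj_std_le fun n x _ => ?_)⟩
  exact hmax ⟨_, hs.insert ⟨n, x⟩, rfl⟩ (Sub.span_mono (Set.subset_insert _ _)) _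
    (Sub.mem_span (Set.mem_insert _ _))

section Groebner

open FI

variable {ι : Type*} {d : ι → ℕ} (v : ∀ i, V.obj (std (d i)))

/-- The value of a monomial, the generators being sent to the elements `v i` of `V`. -/
def evalMonomial {N : ℕ} (m : Monomial d N) : V.obj (std N) :=
  (V.map m.hom).hom (v m.gen)

theorem map_evalMonomial {N N' : ℕ} (g : Fin N ↪o Fin N') (m : Monomial d N) :
    (V.map (orderHom g)).hom (evalMonomial v m) = evalMonomial v (m.map g) :=
  (congrArg (fun h => h.hom (v m.gen)) (V.map_comp m.hom (orderHom g))).symm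

/-- A sub-`FI`-module is recorded by its left ideals of leading coefficients, which grow along
divisibility of monomials. -/
noncomputable def leadingIdeals [LinearOrder ι] (W : Sub V) : Monomial.Total d →o Ideal k where
  toFun m := leadingCoeffs (evalMonomial v) m.monomial (W.obj (std m.degree))
  monotone' := by
    intro ⟨N, m⟩ ⟨N', m'⟩ ⟨(g : Fin N ↪o Fin N'), (hg : m.map g = m')⟩
    subst hg
    exact leadingCoeffs_le_of_map_le (Monomial.map_strictMono g) (map_evalMonomial v g)
      (Submodule.map_le_iff_le_comap.2 (W.map_mem _)) m

theorem leadingIdeals_strictMono [LinearOrder ι] [Finite ι]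
    (hv : Sub.span (Set.range fun i => ⟨d i, v i⟩) = ⊤) : StrictMono (leadingIdeals v) := by
  intro W W' h
  refine lt_of_le_not_ge (fun m => leadingCoeffs_mono _ _ (h.le _)) fun h' =>
    h.not_ge (Sub.le_of_obj_std_le fun N => le_of_leadingCoeffs_le (b := evalMonomial v) ?_
      (h.le _) fun m => h' ⟨N, m⟩)
  have hN : (Sub.span (Set.range fun i => ⟨d i, v i⟩)).obj (std N) = ⊤ := by rw [hv]; rfl
  refine top_unique (hN.ge.trans (Submodule.span_mono ?_))
  rintro _ ⟨_, ⟨i, rfl⟩, f, rfl⟩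
  exact ⟨⟨i, f⟩, rfl⟩

end Groebner

theorem IsFinitelyGenerated.isNoetherian [IsNoetherianRing k] (hV : V.IsFinitelyGenerated) :
    isNoetherian k V := by
  obtain ⟨s, hs, hspan⟩ := isFinitelyGenerated_iff_span.1 hV
  have : Finite s := hs
  let : LinearOrder s := IsWellOrder.linearOrder WellOrderingRel
  have : WellFoundedGT (FI.Monomial.Total (fun x : s => x.1.1) →o Ideal k) :=
    wellFoundedGT_orderHom
  refine (leadingIdeals_strictMono (fun x : s => x.1.2) ?_).wellFoundedGT
  simpa using hspan

end FIModule

namespace FirstQuadrant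

variable {C : Type*} [Category C] [Abelian C] (P : ObjectProperty C)
  {E : E₂CohomologicalSpectralSequenceNat C}

theorem prop_term [P.IsClosedUnderSubobjects] [P.IsClosedUnderQuotients] {p q : ℕ}
    (h : P (term E 2 p q)) {r : ℤ} (hr : 2 ≤ r) : P (term E r p q) := by
  induction r, hr using Int.leInduction with
  | base => exact h
  | succ r hr ih =>
    have hcycles := P.prop_of_mono ((E.page r hr).iCycles (p, q)) ih
    have hhomology := P.prop_of_epi ((E.page r hr).homologyπ (p, q)) hcycles
    exact P.prop_of_epi (E.iso r (r + 1) (p, q)).hom hhomology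

namespace ConvergesTo

variable [P.ContainsZero] [P.IsClosedUnderIsomorphisms] [P.IsClosedUnderExtensions] {H : ℕ → C}
  {n : ℕ}

theorem prop_filtration (hconv : ConvergesTo E H) (h : ∀ p q, p + q = n → P (infTerm E p q)) {p : ℕ}
    (hp : p ≤ n + 1) : P (hconv.F n p : C) := by
  induction hp using Nat.decreasingInduction with
  | self =>
    rw [hconv.F_last]
    exact P.prop_of_isZero ((isZero_zero _).of_iso Subobject.botCoeIsoZero)
  | of_succ p hp ih =>
    let i := Subobject.ofLE (hconv.F n (p + 1)) (hconv.F n p) (hconv.antitone n p.le_succ)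
    have hpq : p + (n - p) = n := by lia
    have hgraded : P (cokernel i) :=
      P.prop_of_iso (hconv.gradedIso n p (n - p) hpq).symm (h p (n - p) hpq)
    have hi : (ShortComplex.mk i (cokernel.π i) (cokernel.condition i)).ShortExact :=
      { exact := ShortComplex.exact_cokernel i }
    exact P.prop_X₂_of_shortExact hi ih hgraded

theorem prop_of_infTerm (hconv : ConvergesTo E H)
    (h : ∀ p q, p + q = n → P (infTerm E p q)) : P (H n) := by
  have hF := prop_filtration P hconv h n.succ.zero_le
  rw [hconv.F_zero] at hF
  exact P.prop_of_iso (asIso (⊤ : Subobject (H n)).arrow) hF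

end ConvergesTo

theorem ConvergesTo.prop_of_isSerreClass [P.IsSerreClass] {H : ℕ → C}
    (hconv : ConvergesTo E H) {n : ℕ} (h : ∀ p q, p + q = n → P (term E 2 p q)) : P (H n) :=
  hconv.prop_of_infTerm P fun p q hpq => prop_term P (h p q hpq) (by lia)

end FirstQuadrant

theorem theorem4p6_general {k : Type u} [Ring k] [IsNoetherianRing k]
    {E : E₂CohomologicalSpectralSequenceNat (FIModule.{v} k)} {H : ℕ → FIModule.{v} k}
    (hconv : FirstQuadrant.ConvergesTo E H) {n : ℕ}
    (hE : ∀ p q : ℕ, p + q = n → (FirstQuadrant.term E 2 p q).IsFinitelyGenerated) :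
    (H n).IsFinitelyGenerated :=
  (hconv.prop_of_isSerreClass (FIModule.isNoetherian k) fun p q hpq =>
    (hE p q hpq).isNoetherian).isFinitelyGenerated

theorem theorem4p6 {k : Type u} [Ring k] [IsNoetherianRing k]
    (E : E₂CohomologicalSpectralSequenceNat (FIModule.{v} k))
    (H : ℕ → FIModule.{v} k)
    (hconv : FirstQuadrant.ConvergesTo E H)
    (hE : ∀ p q : ℕ, ((E.page 2 le_rfl).X (p, q)).IsFinitelyGenerated)
    (i : ℕ) :
    (H i).IsFinitelyGenerated :=
  theorem4p6_general hconv fun p q _ => hE p q
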